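/- Proposition 3.13. Let $\mathcal{A}',\mathcal{A},\mathcal{A}''$ be abelian categories with enough projective and enough injective objects, and let $(\mathcal{A}',\mathcal{A},\mathcal{A}'',i^*,i_*,i^!,j_!,j^*,j_*)$ be a recollement: $i_*:\mathcal{A}'\to\mathcal{A}$ has left adjoint $i^*$ and right adjoint $i^!$, $j^*:\mathcal{A}\to\mathcal{A}''$ has left adjoint $j_!$ and right adjoint $j_*$, the functors $i_*,j_!,j_*$ are fully faithful, and $\operatorname{Ker} j^*$ is the essential image of $i_*$. Assume condition (P): the counit $j_!j^*P\to P$ is a monomorphism for every projective object $P$ of $\mathcal{A}$. For a class of objects $\mathcal{C}$ of an abelian category let $\mathcal{C}^{\perp}=\{X\mid \operatorname{Ext}^1(C,X)=0 \text{ for all } C\in\mathcal{C}\}$ and ${}^{\perp}\mathcal{C}=\{X\mid \operatorname{Ext}^1(X,C)=0 \text{ for all } C\in\mathcal{C}\}$. A pair $(\mathcal{C},\mathcal{D})$ is a cotorsion pair if $\mathcal{C}^{\perp}=\mathcal{D}$ and ${}^{\perp}\mathcal{D}=\mathcal{C}$. It is complete if for every object $M$ there are short exact sequences $0\to D_1\to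 C_1\to M\to 0$ and $0\to M\to D_2\to C_2\to 0$ with $C_1,C_2\in\mathcal{C}$ and $D_1,D_2\in\mathcal{D}$. It is hereditary if $\mathcal{C}$ is closed under kernels of epimorphisms between its objects and $\mathcal{D}$ is closed under cokernels of monomorphisms between its objects. Let $\mathcal{U}',\mathcal{V}'$ be classes of objects of $\mathcal{A}'$ and $\mathcal{U}'',\mathcal{V}''$ classes of objects of $\mathcal{A}''$, all closed under isomorphisms, and put $$\mathcal{M}^{\mathcal{U}'}_{\mathcal{U}''}=\{X\in\mathcal{A}\mid i^*X\in\mathcal{U}',\ j^*X\in\mathcal{U}'',\ (\mathbb{L}_1i^*)(X)=0\},$$ $$\mathcal{N}^{\mathcal{V}'}_{\mathcal{V}''}=\{X\in\mathcal{A}\mid i^!X\in\mathcal{V}',\ j^*X\in\mathcal{V}'',\ (\mathbb{R}_1i^!)(X)=0\},$$ where $\mathbb{L}_1$ and $\mathbb{R}_1$ denote first left and right derived functors. Assume that $(\mathcal{M}^{\mathcal{U}'}_{\mathcal{U}''},\mathcal{N}^{\mathcal{V}'}_{\mathcal{V}''})$ is a complete hereditary cotorsion pair in $\mathcal{A}$,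 that $(\mathbb{R}_1j_*)(Y)=0$ for all $Y\in\mathcal{U}''^{\perp}$, that $(\mathbb{L}_1j_!)(Y)=0$ for all $Y\in{}^{\perp}\mathcal{V}''$, and that either $(\mathbb{L}_1j_!)(Y)=0$ for all $Y\in\mathcal{U}''$ or $(\mathbb{R}_1j_*)(Y)=0$ for all $Y\in\mathcal{V}''$. Assume moreover that at least one of the following holds: (1) $i^*j_*Y\in\mathcal{V}'$ and $(\mathbb{L}_1i^*)(j_*Y)=0$ for all $Y\in\mathcal{V}''$; (2) $i^!j_!Y\in\mathcal{U}'$ and $(\mathbb{R}_1i^!)(j_!Y)=0$ for all $Y\in\mathcal{U}''$. Then $(\mathcal{U}',\mathcal{V}')$ and $(\mathcal{U}'',\mathcal{V}'')$ are complete hereditary cotorsion pairs in $\mathcal{A}'$ and $\mathcal{A}''$, respectively. -/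

import Mathlib

open CategoryTheory CategoryTheory.Limits

universe v' v v'' u' u u''

/-- `Ext¹(X, Y) = 0`. In the presence of enough projectives, Mathlib's `Ext` groups live in the
universe of morphisms of the category. -/
def ExtOneVanishes {C : Type u} [Category.{v} C] [Abelian C] [EnoughProjectives C]
    (X Y : C) : Prop :=
  haveI : HasExt.{v} C := hasExt_of_enoughProjectives.{v} C
  Subsingleton (Abelian.Ext.{v} X Y 1)

/-- `𝒞^⊥`: the objects `X` with `Ext¹(Z, X) = 0` for all `Z ∈ 𝒞`. -/
def rightExtPerp {C : Type u} [Category.{v} C] [Abelian C] [EnoughProjectives C]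
    (𝒞 : ObjectProperty C) : ObjectProperty C :=
  fun X => ∀ Z : C, 𝒞 Z → ExtOneVanishes Z X

/-- `^⊥𝒟`: the objects `Y` with `Ext¹(Y, D) = 0` for all `D ∈ 𝒟`. -/
def leftExtPerp {C : Type u} [Category.{v} C] [Abelian C] [EnoughProjectives C]
    (𝒟 : ObjectProperty C) : ObjectProperty C :=
  fun Y => ∀ D : C, 𝒟 D → ExtOneVanishes Y D

/-- A cotorsion pair in an abelian category with enough projectives. -/
structure IsCotorsionPair {C : Type u} [Category.{v} C] [Abelian C] [EnoughProjectives C]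
    (𝒞 𝒟 : ObjectProperty C) : Prop where
  rightPerp_eq : rightExtPerp 𝒞 = 𝒟
  leftPerp_eq : leftExtPerp 𝒟 = 𝒞

/-- Completeness of a pair of classes: every object `M` fits into short exact sequences
`0 → D₁ → C₁ → M → 0` and `0 → M → D₂ → C₂ → 0` with `Cᵢ ∈ 𝒞` and `Dᵢ ∈ 𝒟`. -/
structure IsCompletePair {C : Type u} [Category.{v} C] [Abelian C]
    (𝒞 𝒟 : ObjectProperty C) : Prop where
  exists_precover : ∀ M : C, ∃ (D₁ C₁ : C) (k : D₁ ⟶ C₁) (f : C₁ ⟶ M) (w : k ≫ f = 0),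
    (ShortComplex.mk k f w).ShortExact ∧ 𝒞 C₁ ∧ 𝒟 D₁
  exists_preenvelope : ∀ M : C, ∃ (D₂ C₂ : C) (g : M ⟶ D₂) (p : D₂ ⟶ C₂) (w : g ≫ p = 0),
    (ShortComplex.mk g p w).ShortExact ∧ 𝒞 C₂ ∧ 𝒟 D₂

/-- Heredity of a pair of classes: `𝒞` is closed under kernels of epimorphisms and `𝒟` is closed
under cokernels of monomorphisms. -/
structure IsHereditaryPair {C : Type u} [Category.{v} C] [Abelian C]
    (𝒞 𝒟 : ObjectProperty C) : Prop where
  kernel_mem : ∀ S : ShortComplex C, S.ShortExact → 𝒞 S.X₂ → 𝒞 S.X₃ → 𝒞 S.X₁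
  cokernel_mem : ∀ S : ShortComplex C, S.ShortExact → 𝒟 S.X₁ → 𝒟 S.X₂ → 𝒟 S.X₃

/-- A complete hereditary cotorsion pair. -/
structure IsCompleteHereditaryCotorsionPair {C : Type u} [Category.{v} C] [Abelian C]
    [EnoughProjectives C] (𝒞 𝒟 : ObjectProperty C) : Prop where
  cotorsion : IsCotorsionPair 𝒞 𝒟
  complete : IsCompletePair 𝒞 𝒟
  hereditary : IsHereditaryPair 𝒞 𝒟

/-- A recollement of the abelian category `A` relative to `A'` and `A''`. -/
structure AbelianRecollement (A' : Type u') [Category.{v'} A'] [Abelian A']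
    (A : Type u) [Category.{v} A] [Abelian A]
    (A'' : Type u'') [Category.{v''} A''] [Abelian A''] where
  /-- the functor `i^*` -/
  iUpperStar : A ⥤ A'
  /-- the functor `i_*` -/
  iLowerStar : A' ⥤ A
  /-- the functor `i^!` -/
  iUpperShriek : A ⥤ A'
  /-- the functor `j_!` -/
  jLowerShriek : A'' ⥤ A
  /-- the functor `j^*` -/
  jUpperStar : A ⥤ A''
  /-- the functor `j_*` -/
  jLowerStar : A'' ⥤ A
  /-- `i^* ⊣ i_*` -/
  adjIStar : iUpperStar ⊣ iLowerStar
  /-- `i_* ⊣ i^!` -/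
  adjIShriek : iLowerStar ⊣ iUpperShriek
  /-- `j_! ⊣ j^*` -/
  adjJShriek : jLowerShriek ⊣ jUpperStar
  /-- `j^* ⊣ j_*` -/
  adjJStar : jUpperStar ⊣ jLowerStar
  full_iLowerStar : iLowerStar.Full
  faithful_iLowerStar : iLowerStar.Faithful
  full_jLowerShriek : jLowerShriek.Full
  faithful_jLowerShriek : jLowerShriek.Faithful
  full_jLowerStar : jLowerStar.Full
  faithful_jLowerStar : jLowerStar.Faithful
  /-- `Ker j^* = Im i_*` (essential image) -/
  kernel_eq_image : ∀ X : A, IsZero (jUpperStar.obj X) ↔ iLowerStar.essImage X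

namespace AbelianRecollement

section

variable {A' : Type u'} [Category.{v'} A'] [Abelian A']
  {A : Type u} [Category.{v} A] [Abelian A]
  {A'' : Type u''} [Category.{v''} A''] [Abelian A'']
  (R : AbelianRecollement A' A A'')

instance additive_iLowerStar : R.iLowerStar.Additive := by
  have := R.adjIStar.rightAdjoint_preservesLimits
  exact R.iLowerStar.additive_of_preserves_binary_products

instance additive_jUpperStar : R.jUpperStar.Additive := by
  have := R.adjJShriek.rightAdjoint_preservesLimits
  exact R.jUpperStar.additive_of_preserves_binary_products

instance additive_iUpperStar : R.iUpperStar.Additive :=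
  R.adjIStar.left_adjoint_additive

instance additive_iUpperShriek : R.iUpperShriek.Additive :=
  R.adjIShriek.right_adjoint_additive

instance additive_jLowerShriek : R.jLowerShriek.Additive :=
  R.adjJShriek.left_adjoint_additive

instance additive_jLowerStar : R.jLowerStar.Additive :=
  R.adjJStar.right_adjoint_additive

/-- Condition (P): the counit `j_! j^* P ⟶ P` is a monomorphism for every projective `P`. -/
def ConditionP : Prop :=
  ∀ P : A, Projective P → Mono (R.adjJShriek.counit.app P)

/-- The class `ℳ^𝒳_𝒴` of all `X` with `i^* X ∈ 𝒳`, `j^* X ∈ 𝒴` and `(L₁ i^*) X = 0`. -/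
def gluedM [EnoughProjectives A] (𝒳 : ObjectProperty A') (𝒴 : ObjectProperty A'') :
    ObjectProperty A :=
  fun X => 𝒳 (R.iUpperStar.obj X) ∧ 𝒴 (R.jUpperStar.obj X) ∧
    IsZero ((R.iUpperStar.leftDerived 1).obj X)

/-- The class `𝒩^𝒳_𝒴` of all `X` with `i^! X ∈ 𝒳`, `j^* X ∈ 𝒴` and `(R₁ i^!) X = 0`. -/
def gluedN [EnoughInjectives A] (𝒳 : ObjectProperty A') (𝒴 : ObjectProperty A'') :
    ObjectProperty A :=
  fun X => 𝒳 (R.iUpperShriek.obj X) ∧ 𝒴 (R.jUpperStar.obj X) ∧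
    IsZero ((R.iUpperShriek.rightDerived 1).obj X)

end

end AbelianRecollement

/-! The glued classes M and N remember the four smaller classes, because i_*, j_! and j_* embed A'
and A'' in A. By (P) and the snake lemma, L₁i^* vanishes at X exactly when the counit j_!j^*X ⟶ X is
a monomorphism. Hence L₁i^* vanishes on the images of i_* and j_!, so that i_*X ∈ M iff X ∈ U', and
j_!Y ∈ M iff Y ∈ U''. Condition (P) passes to the opposite recollement, so dually i_*X ∈ N iff X ∈
V', and j_*Y ∈ N iff Y ∈ V''.

For F ⊣ G with G exact and L₁F(X) = 0, Ext¹(FX, Y) and Ext¹(X, GY) vanish together; dually with F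
exact and R₁G(Y) = 0. Applied to i^* ⊣ i_*, j_! ⊣ j^* and j^* ⊣ j_*, this carries orthogonality
between A and the two sides. Heredity is tested after applying i_*, j_! or j_*. Completeness on A''
comes from applying j^* to approximations of j_*M, and on A' from applying i^* to approximations of
i_*M. For the latter, (1) ensures that i^* maps N into V'; case (2) is case (1) for the opposite
recollement. -/

/-! ### Vanishing of Ext¹ as an extension or lifting property -/

section Ext

variable {C : Type u} [Category.{v} C] [Abelian C] [EnoughProjectives C]

/-- If `Ext¹(X₃, Y) = 0`, morphisms to `Y` extend along the monomorphism of a short exact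
sequence ending in `X₃`. -/
theorem ExtOneVanishes.exists_extension {S : ShortComplex C} (hS : S.ShortExact) {Y : C}
    (h : ExtOneVanishes S.X₃ Y) (φ : S.X₁ ⟶ Y) : ∃ ψ : S.X₂ ⟶ Y, S.f ≫ ψ = φ := by
  have : HasExt.{v} C := hasExt_of_enoughProjectives.{v} C
  have h' : Subsingleton (Abelian.Ext.{v} S.X₃ Y 1) := h
  obtain ⟨x, hx⟩ := Abelian.Ext.contravariant_sequence_exact₁ hS (Y := Y) (Abelian.Ext.mk₀ φ)
    (add_zero 1) (Subsingleton.elim _ _)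
  obtain ⟨ψ, rfl⟩ := (Abelian.Ext.mk₀_bijective _ _).2 x
  refine ⟨ψ, (Abelian.Ext.mk₀_bijective _ _).1 ?_⟩
  rw [← hx, Abelian.Ext.mk₀_comp_mk₀]

/-- If `Ext¹(X, X₁) = 0`, morphisms from `X` lift along the epimorphism of a short exact
sequence starting in `X₁`. -/
theorem ExtOneVanishes.exists_lift {S : ShortComplex C} (hS : S.ShortExact) {X : C}
    (h : ExtOneVanishes X S.X₁) (φ : X ⟶ S.X₃) : ∃ ψ : X ⟶ S.X₂, ψ ≫ S.g = φ := by
  have : HasExt.{v} C := hasExt_of_enoughProjectives.{v} C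
  have h' : Subsingleton (Abelian.Ext.{v} X S.X₁ 1) := h
  obtain ⟨x, hx⟩ := Abelian.Ext.covariant_sequence_exact₃ X hS (Abelian.Ext.mk₀ φ)
    (zero_add 1) (Subsingleton.elim _ _)
  obtain ⟨ψ, rfl⟩ := (Abelian.Ext.mk₀_bijective _ _).2 x
  refine ⟨ψ, (Abelian.Ext.mk₀_bijective _ _).1 ?_⟩
  rw [← hx, Abelian.Ext.mk₀_comp_mk₀]

/-- Ext¹(X₂, Y) = 0, so the long exact sequence makes Ext¹(X₃, Y) the cokernel of Hom(X₂, Y) ⟶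
Hom(X₁, Y). In this form vanishing can be transported along adjunctions and to opposite categories.
-/
theorem extOneVanishes_iff_of_projective {S : ShortComplex C} (hS : S.ShortExact)
    [Projective S.X₂] (Y : C) :
    ExtOneVanishes S.X₃ Y ↔ ∀ φ : S.X₁ ⟶ Y, ∃ ψ : S.X₂ ⟶ Y, S.f ≫ ψ = φ := by
  refine ⟨fun h => h.exists_extension hS, fun h => ?_⟩
  have : HasExt.{v} C := hasExt_of_enoughProjectives.{v} C
  refine subsingleton_of_forall_eq (α := Abelian.Ext.{v} S.X₃ Y 1) 0 fun x => ?_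
  obtain ⟨y, rfl⟩ := Abelian.Ext.contravariant_sequence_exact₃ hS (Y := Y) x
    (Abelian.Ext.eq_zero_of_projective _) (add_zero 1)
  obtain ⟨φ, rfl⟩ := (Abelian.Ext.mk₀_bijective _ _).2 y
  obtain ⟨ψ, rfl⟩ := h φ
  rw [← Abelian.Ext.mk₀_comp_mk₀]
  exact hS.extClass_comp_assoc _

theorem extOneVanishes_iff_of_injective {S : ShortComplex C} (hS : S.ShortExact)
    [Injective S.X₂] (X : C) :
    ExtOneVanishes X S.X₁ ↔ ∀ φ : X ⟶ S.X₃, ∃ ψ : X ⟶ S.X₂, ψ ≫ S.g = φ := by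
  refine ⟨fun h => h.exists_lift hS, fun h => ?_⟩
  have : HasExt.{v} C := hasExt_of_enoughProjectives.{v} C
  refine subsingleton_of_forall_eq (α := Abelian.Ext.{v} X S.X₁ 1) 0 fun x => ?_
  obtain ⟨y, rfl⟩ := Abelian.Ext.covariant_sequence_exact₁ X hS x
    (Abelian.Ext.eq_zero_of_injective _) (zero_add 1)
  obtain ⟨φ, rfl⟩ := (Abelian.Ext.mk₀_bijective _ _).2 y
  obtain ⟨ψ, rfl⟩ := h φ
  rw [← Abelian.Ext.mk₀_comp_mk₀, Abelian.Ext.comp_assoc_of_second_deg_zero, hS.comp_extClass,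
    Abelian.Ext.comp_zero]

theorem ExtOneVanishes.of_isZero_left {X : C} (hX : IsZero X) (Y : C) : ExtOneVanishes X Y := by
  have : HasExt.{v} C := hasExt_of_enoughProjectives.{v} C
  have : Projective X := hX.projective
  exact subsingleton_of_forall_eq (α := Abelian.Ext.{v} X Y 1) 0
    fun _ => Abelian.Ext.eq_zero_of_projective _

/-- `Ext¹(X, -) = 0` is inherited by extensions. -/
theorem ExtOneVanishes.of_shortExact_right {S : ShortComplex C} (hS : S.ShortExact) {X : C}
    (h₁ : ExtOneVanishes X S.X₁) (h₃ : ExtOneVanishes X S.X₃) : ExtOneVanishes X S.X₂ := by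
  have : HasExt.{v} C := hasExt_of_enoughProjectives.{v} C
  have h₁' : Subsingleton (Abelian.Ext.{v} X S.X₁ 1) := h₁
  have h₃' : Subsingleton (Abelian.Ext.{v} X S.X₃ 1) := h₃
  refine subsingleton_of_forall_eq (α := Abelian.Ext.{v} X S.X₂ 1) 0 fun x => ?_
  obtain ⟨y, rfl⟩ := Abelian.Ext.covariant_sequence_exact₂ X hS x (Subsingleton.elim _ _)
  rw [Subsingleton.elim y 0, Abelian.Ext.zero_comp]

theorem extOneVanishes_congr {X X' Y Y' : C} (e : X ≅ X') (e' : Y ≅ Y') :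
    ExtOneVanishes X Y ↔ ExtOneVanishes X' Y' := by
  suffices ∀ {X X' Y Y' : C} (_ : X ≅ X') (_ : Y ≅ Y'), ExtOneVanishes X Y → ExtOneVanishes X' Y'
    from ⟨this e e', this e.symm e'.symm⟩
  intro X X' Y Y' e e' h
  have : HasExt.{v} C := hasExt_of_enoughProjectives.{v} C
  have h' : Subsingleton (Abelian.Ext.{v} X Y 1) := h
  refine subsingleton_of_forall_eq (α := Abelian.Ext.{v} X' Y' 1) 0 fun x => ?_
  have hx : (Abelian.Ext.mk₀ e.hom).comp (x.comp (Abelian.Ext.mk₀ e'.inv) (add_zero 1))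
      (zero_add 1) = 0 := Subsingleton.elim _ _
  have hx' := congrArg (fun y => (Abelian.Ext.mk₀ e.inv).comp
    (y.comp (Abelian.Ext.mk₀ e'.hom) (add_zero 1)) (zero_add 1)) hx
  simpa using hx'

theorem exists_projective_presentation (X : C) :
    ∃ S : ShortComplex C, S.ShortExact ∧ Projective S.X₂ ∧ S.X₃ = X :=
  ⟨ShortComplex.mk (kernel.ι (Projective.π X)) (Projective.π X) (kernel.condition _),
    { exact := ShortComplex.exact_kernel _ }, Projective.projective_over X, rfl⟩

theorem exists_injective_copresentation {C : Type u} [Category.{v} C] [Abelian C]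
    [EnoughInjectives C] (X : C) :
    ∃ S : ShortComplex C, S.ShortExact ∧ Injective S.X₂ ∧ S.X₁ = X :=
  ⟨ShortComplex.mk (Injective.ι X) (cokernel.π (Injective.ι X)) (cokernel.condition _),
    { exact := ShortComplex.exact_cokernel _ }, Injective.injective_under X, rfl⟩

/-- An injective copresentation of Y is a projective presentation of Y in the opposite category, and
the lifting problem for one is the extension problem for the other. -/
theorem extOneVanishes_op_iff [EnoughInjectives C] (X Y : C) :
    ExtOneVanishes (Opposite.op Y) (Opposite.op X) ↔ ExtOneVanishes X Y := by
  obtain ⟨S, hS, hI, rfl⟩ := exists_injective_copresentation Y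
  have : Projective S.op.X₂ := inferInstanceAs (Projective (Opposite.op S.X₂))
  refine (extOneVanishes_iff_of_projective hS.op (Opposite.op X)).trans
    (Iff.trans ⟨fun h φ => ?_, fun h φ => ?_⟩ (extOneVanishes_iff_of_injective hS X).symm)
  · obtain ⟨ψ, hψ⟩ := h φ.op
    exact ⟨ψ.unop, Quiver.Hom.op_inj hψ⟩
  · obtain ⟨ψ, hψ⟩ := h φ.unop
    exact ⟨ψ.op, Quiver.Hom.unop_inj hψ⟩

end Ext

/-! ### First derived functors read off a single presentation -/

section Derived

variable {C : Type u} [Category.{v} C] [Abelian C]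
  {D : Type u'} [Category.{v'} D] [Abelian D]

/-- A morphism of short exact sequences that is an isomorphism on the third terms induces a
pushout square on the first two. -/
theorem isPushout_of_shortExact {T S : ShortComplex C} (hT : T.ShortExact) (hS : S.ShortExact)
    (φ : T ⟶ S) [IsIso φ.τ₃] : IsPushout T.f φ.τ₁ φ.τ₂ S.f := by
  have := hT.mono_f
  have := hS.mono_f
  have := hT.epi_g
  have sq : CommSq T.f φ.τ₁ φ.τ₂ S.f := ⟨φ.comm₁₂.symm⟩
  -- The square is a pushout once X₁(T) ⟶ X₂(T) ⊞ X₁(S) ⟶ X₂(S) ⟶ 0 is exact.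
  have hex : sq.shortComplex.Exact := by
    rw [ShortComplex.exact_iff_exact_up_to_refinements]
    intro A (x : A ⟶ T.X₂ ⊞ S.X₁) (hx : x ≫ biprod.desc φ.τ₂ S.f = 0)
    have hx' : x ≫ biprod.fst ≫ φ.τ₂ + x ≫ biprod.snd ≫ S.f = 0 := by
      simpa [biprod.desc_eq] using hx
    have h1 : (x ≫ biprod.fst) ≫ T.g = 0 := by
      rw [← cancel_mono φ.τ₃]
      have := hx' =≫ S.g
      simpa [φ.comm₂₃] using this
    obtain ⟨t, ht⟩ := hT.exact.lift' _ h1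
    have h2 : x ≫ biprod.snd = - (t ≫ φ.τ₁) := by
      rw [← cancel_mono S.f, Category.assoc, eq_neg_of_add_eq_zero_right hx', ← reassoc_of% ht]
      simp [φ.comm₁₂]
    have h3 : x = t ≫ biprod.lift T.f (-φ.τ₁) := by
      apply biprod.hom_ext
      · simpa using ht.symm
      · simpa using h2
    exact ⟨A, 𝟙 _, inferInstance, t, (Category.id_comp x).trans h3⟩
  have hepi : Epi sq.shortComplex.g := by
    change Epi (biprod.desc φ.τ₂ S.f)
    rw [epi_iff_surjective_up_to_refinements]
    intro A y
    -- Choose z in X₂(T) with the same image as y in the common third term; y then differs from the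
    -- image of z by an element of X₁(S).
    obtain ⟨A', π, hπ, z, hz⟩ :=
      surjective_up_to_refinements_of_epi T.g (y ≫ S.g ≫ inv φ.τ₃)
    have h1 : (π ≫ y - z ≫ φ.τ₂) ≫ S.g = 0 := by
      have := hz =≫ φ.τ₃
      simp only [Category.assoc, IsIso.inv_hom_id, Category.comp_id] at this
      simp [this, φ.comm₂₃]
    obtain ⟨t, ht⟩ := hS.exact.lift' _ h1
    exact ⟨A', π, hπ, biprod.lift z t, by simp [ht]⟩
  exact ⟨sq, ⟨sq.isColimitEquivIsColimitCokernelCofork.symm hex.gIsCokernel⟩⟩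

/-- If a right exact functor sends the monomorphism of a projective presentation to a
monomorphism, it does so for every short exact sequence with the same end term. -/
theorem mono_map_of_projective (F : C ⥤ D) [PreservesFiniteColimits F] {T S : ShortComplex C}
    (hT : T.ShortExact) (hS : S.ShortExact) [Projective T.X₂] (e : T.X₃ ≅ S.X₃)
    [Mono (F.map T.f)] : Mono (F.map S.f) := by
  have := hS.epi_g
  have := hS.mono_f
  let b : T.X₂ ⟶ S.X₂ := Projective.factorThru (T.g ≫ e.hom) S.g
  have hb : b ≫ S.g = T.g ≫ e.hom := Projective.factorThru_comp _ _
  let a : T.X₁ ⟶ S.X₁ := hS.exact.lift (T.f ≫ b) (by simp [hb])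
  let φ : T ⟶ S := { τ₁ := a, τ₂ := b, τ₃ := e.hom, comm₁₂ := by simp [a], comm₂₃ := hb }
  have : IsIso φ.τ₃ := inferInstanceAs (IsIso e.hom)
  -- F preserves the pushout square, and pushouts of monomorphisms in an abelian category are
  -- monomorphisms.
  have hp := (isPushout_of_shortExact hT hS φ).map F
  exact Abelian.mono_inr_of_isColimit _ _ hp.isColimit

/-- Right exactness keeps X₁ ⟶ X₂ ⟶ K ⟶ 0 exact, so the kernel of F(X₂) ⟶ F(X₃) exceeds the image of
F(X₁) exactly when F(k) has a kernel. -/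
theorem exact_map_iff_mono (F : C ⥤ D) [F.Additive] [PreservesFiniteColimits F]
    {S : ShortComplex C} (hS : S.Exact) {K : C} (p : S.X₂ ⟶ K) (k : K ⟶ S.X₃) [Epi p] [Mono k]
    (hp : p ≫ k = S.g) : (S.map F).Exact ↔ Mono (F.map k) := by
  have hz : S.f ≫ p = 0 := by rw [← cancel_mono k, Category.assoc, hp, S.zero, zero_comp]
  let T : ShortComplex C := ShortComplex.mk S.f p hz
  let φ : T ⟶ S := { τ₁ := 𝟙 _, τ₂ := 𝟙 _, τ₃ := k, comm₁₂ := by simp [T], comm₂₃ := by simp [T, hp] }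
  have : Epi φ.τ₁ := inferInstanceAs (Epi (𝟙 _))
  have : IsIso φ.τ₂ := inferInstanceAs (IsIso (𝟙 _))
  have : Mono φ.τ₃ := inferInstanceAs (Mono k)
  have hT : T.Exact := (ShortComplex.exact_iff_of_epi_of_isIso_of_mono φ).2 hS
  have hFT : (T.map F).Exact :=
    hT.map_of_epi_of_preservesCokernel F (inferInstanceAs (Epi p)) inferInstance
  constructor
  · intro h
    rw [Preadditive.mono_iff_cancel_zero]
    intro A z hz'
    obtain ⟨A', π, hπ, y, hy⟩ := surjective_up_to_refinements_of_epi (F.map p) z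
    have h1 : y ≫ F.map S.g = 0 := by
      rw [← hp, Functor.map_comp, ← Category.assoc, ← hy, Category.assoc, hz', comp_zero]
    obtain ⟨A'', π', hπ', (x : A'' ⟶ F.obj S.X₁), (hx : π' ≫ y = x ≫ F.map S.f)⟩ :=
      h.exact_up_to_refinements y h1
    rw [← cancel_epi π, ← cancel_epi π', hy, ← Category.assoc, hx, Category.assoc,
      ← Functor.map_comp, hz, Functor.map_zero, comp_zero, comp_zero, comp_zero]
  · intro h
    let ψ : T.map F ⟶ S.map F := F.mapShortComplex.map φ
    have : Epi ψ.τ₁ := inferInstanceAs (Epi (F.map (𝟙 _)))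
    have : IsIso ψ.τ₂ := inferInstanceAs (IsIso (F.map (𝟙 _)))
    have : Mono ψ.τ₃ := h
    exact (ShortComplex.exact_iff_of_epi_of_isIso_of_mono ψ).1 hFT

/-- For the chosen resolution P, exactness of F(P) in degree 1 says that F keeps the first syzygy
inside P₀. Comparing presentations in both directions replaces this syzygy by the given one. -/
theorem isZero_leftDerived_one_iff [EnoughProjectives C] (F : C ⥤ D) [F.Additive]
    [PreservesFiniteColimits F] {S : ShortComplex C} (hS : S.ShortExact) [Projective S.X₂] :
    IsZero ((F.leftDerived 1).obj S.X₃) ↔ Mono (F.map S.f) := by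
  let P := projectiveResolution S.X₃
  have e₀ : (F.leftDerived 1).obj S.X₃ ≅
    ((F.mapHomologicalComplex _).obj P.complex).homology 1 := P.isoLeftDerivedObj F 1
  have h₁ : IsZero ((F.leftDerived 1).obj S.X₃) ↔
      ((ShortComplex.mk _ _ (P.complex.d_comp_d 2 1 0)).map F).Exact := by
    rw [e₀.isZero_iff, ← HomologicalComplex.exactAt_iff_isZero_homology,
      HomologicalComplex.exactAt_iff' _ 2 1 0 (by simp) (by simp)]
    rfl
  obtain ⟨q, hq, hdq, hex⟩ : ∃ (q : P.complex.X 0 ⟶ S.X₃) (_ : Epi q)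
      (w : P.complex.d 1 0 ≫ q = 0), (ShortComplex.mk _ _ w).Exact :=
    ⟨P.π.f 0, inferInstanceAs (Epi (P.π.f 0)), P.complex_d_comp_π_f_zero, P.exact₀⟩
  let T : ShortComplex C := ShortComplex.mk (kernel.ι q) q (kernel.condition q)
  have hT : T.ShortExact :=
    { exact := ShortComplex.exact_kernel _, epi_g := hq,
      mono_f := inferInstanceAs (Mono (kernel.ι q)) }
  have : Projective T.X₂ := inferInstanceAs (Projective (P.complex.X 0))
  let p : P.complex.X 1 ⟶ kernel q := kernel.lift _ (P.complex.d 1 0) hdq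
  have : Epi p := hex.epi_kernelLift
  let e : T.X₃ ≅ S.X₃ := Iso.refl _
  rw [h₁, exact_map_iff_mono F (P.exact_succ 0) p (kernel.ι q) (kernel.lift_ι _ _ _)]
  exact ⟨fun h => have : Mono (F.map T.f) := h; mono_map_of_projective F hT hS e,
    fun h => mono_map_of_projective F hS hT e.symm⟩

/-- If `L₁F` vanishes on the end term of a short exact sequence, the right exact functor `F`
preserves this sequence. -/
theorem shortExact_map_of_isZero_leftDerived [EnoughProjectives C] (F : C ⥤ D) [F.Additive]
    [PreservesFiniteColimits F] {S : ShortComplex C} (hS : S.ShortExact)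
    (h : IsZero ((F.leftDerived 1).obj S.X₃)) : (S.map F).ShortExact := by
  obtain ⟨T, hT, hTP, hTS⟩ := exists_projective_presentation S.X₃
  rw [← hTS, isZero_leftDerived_one_iff F hT] at h
  have := hS.epi_g
  exact
    { exact := hS.exact.map_of_epi_of_preservesCokernel F hS.epi_g inferInstance
      mono_f := mono_map_of_projective F hT hS (eqToIso hTS)
      epi_g := inferInstanceAs (Epi (F.map S.g)) }

theorem epi_map_of_injective (F : C ⥤ D) [PreservesFiniteLimits F] {T S : ShortComplex C}
    (hT : T.ShortExact) (hS : S.ShortExact) [Injective T.X₂] (e : T.X₁ ≅ S.X₁)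
    [Epi (F.map T.g)] : Epi (F.map S.g) := by
  have := preservesFiniteColimits_op F
  have : Projective T.op.X₂ := inferInstanceAs (Projective (Opposite.op T.X₂))
  have : Mono (F.op.map T.op.f) := inferInstanceAs (Mono (F.map T.g).op)
  have h : Mono (F.map S.g).op := mono_map_of_projective F.op hT.op hS.op e.symm.op
  exact (op_mono_iff _).1 h

theorem exact_map_iff_epi (F : C ⥤ D) [F.Additive] [PreservesFiniteLimits F]
    {S : ShortComplex C} (hS : S.Exact) {K : C} (p : S.X₁ ⟶ K) (k : K ⟶ S.X₂) [Epi p] [Mono k]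
    (hp : p ≫ k = S.f) : (S.map F).Exact ↔ Epi (F.map p) := by
  have := preservesFiniteColimits_op F
  rw [← op_mono_iff, ← ShortComplex.exact_op_iff]
  let k' : S.op.X₂ ⟶ Opposite.op K := k.op
  let p' : Opposite.op K ⟶ S.op.X₃ := p.op
  have : Epi k' := inferInstanceAs (Epi k.op)
  have : Mono p' := inferInstanceAs (Mono p.op)
  exact exact_map_iff_mono F.op hS.op k' p' (congrArg Quiver.Hom.op hp)

theorem isZero_rightDerived_one_iff [EnoughInjectives C] (F : C ⥤ D) [F.Additive]
    [PreservesFiniteLimits F] {S : ShortComplex C} (hS : S.ShortExact) [Injective S.X₂] :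
    IsZero ((F.rightDerived 1).obj S.X₁) ↔ Epi (F.map S.g) := by
  let I := injectiveResolution S.X₁
  have e₀ : (F.rightDerived 1).obj S.X₁ ≅
    ((F.mapHomologicalComplex _).obj I.cocomplex).homology 1 := I.isoRightDerivedObj F 1
  have h₁ : IsZero ((F.rightDerived 1).obj S.X₁) ↔
      ((ShortComplex.mk _ _ (I.cocomplex.d_comp_d 0 1 2)).map F).Exact := by
    rw [e₀.isZero_iff, ← HomologicalComplex.exactAt_iff_isZero_homology,
      HomologicalComplex.exactAt_iff' _ 0 1 2 (by simp) (by simp)]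
    rfl
  obtain ⟨q, hq, hdq, hex⟩ : ∃ (q : S.X₁ ⟶ I.cocomplex.X 0) (_ : Mono q)
      (w : q ≫ I.cocomplex.d 0 1 = 0), (ShortComplex.mk _ _ w).Exact :=
    ⟨I.ι.f 0, inferInstanceAs (Mono (I.ι.f 0)), I.ι_f_zero_comp_complex_d, I.exact₀⟩
  let T : ShortComplex C := ShortComplex.mk q (cokernel.π q) (cokernel.condition q)
  have hT : T.ShortExact :=
    { exact := ShortComplex.exact_cokernel _, mono_f := hq,
      epi_g := inferInstanceAs (Epi (cokernel.π q)) }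
  have : Injective T.X₂ := inferInstanceAs (Injective (I.cocomplex.X 0))
  let p : cokernel q ⟶ I.cocomplex.X 1 := cokernel.desc _ (I.cocomplex.d 0 1) hdq
  have : Mono p := hex.mono_cokernelDesc
  let e : T.X₁ ≅ S.X₁ := Iso.refl _
  rw [h₁, exact_map_iff_epi F (I.exact_succ 0) (cokernel.π q) p (cokernel.π_desc _ _ _)]
  exact ⟨fun h => have : Epi (F.map T.g) := h; epi_map_of_injective F hT hS e,
    fun h => epi_map_of_injective F hS hT e.symm⟩

/-- Both sides are tested on one injective copresentation, whose opposite is a projective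
presentation; no comparison of resolutions is needed. -/
theorem isZero_leftDerived_one_op_iff [EnoughInjectives C] (F : C ⥤ D) [F.Additive]
    [PreservesFiniteLimits F] (X : C) :
    IsZero ((F.op.leftDerived 1).obj (Opposite.op X)) ↔ IsZero ((F.rightDerived 1).obj X) := by
  obtain ⟨S, hS, hI, rfl⟩ := exists_injective_copresentation X
  have : Projective S.op.X₂ := inferInstanceAs (Projective (Opposite.op S.X₂))
  have := preservesFiniteColimits_op F
  rw [isZero_rightDerived_one_iff F hS, ← op_mono_iff]
  exact isZero_leftDerived_one_iff F.op hS.op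

theorem isZero_rightDerived_one_op_iff [EnoughProjectives C] (F : C ⥤ D) [F.Additive]
    [PreservesFiniteColimits F] (X : C) :
    IsZero ((F.op.rightDerived 1).obj (Opposite.op X)) ↔ IsZero ((F.leftDerived 1).obj X) := by
  obtain ⟨S, hS, hP, rfl⟩ := exists_projective_presentation X
  have : Injective S.op.X₂ := inferInstanceAs (Injective (Opposite.op S.X₂))
  have := preservesFiniteLimits_op F
  rw [isZero_leftDerived_one_iff F hS, ← op_epi_iff]
  exact isZero_rightDerived_one_iff F.op hS.op

end Derived

/-! ### Transport of Ext¹ vanishing along adjunctions -/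

section Adjunction

variable {C : Type u} [Category.{v} C] [Abelian C] [EnoughProjectives C]
  {D : Type u'} [Category.{v'} D] [Abelian D] [EnoughProjectives D]

/-- `Ext¹(F X, Y) = 0` if and only if `Ext¹(X, G Y) = 0`, for `F ⊣ G` with `G` exact and
`L₁F` vanishing at `X`. -/
theorem CategoryTheory.Adjunction.extOneVanishes_iff_of_leftDerived {F : C ⥤ D} {G : D ⥤ C}
    (adj : F ⊣ G) [F.Additive] [G.PreservesEpimorphisms] {X : C}
    (hX : IsZero ((F.leftDerived 1).obj X)) (Y : D) :
    ExtOneVanishes (F.obj X) Y ↔ ExtOneVanishes X (G.obj Y) := by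
  have := adj.leftAdjoint_preservesColimits
  obtain ⟨S, hS, hP, rfl⟩ := exists_projective_presentation X
  -- F sends the projective presentation of X to one of FX: it stays exact because L₁F(X) = 0, and F
  -- preserves projectives because G preserves epimorphisms. The two extension problems then
  -- correspond under the adjunction.
  have hFS := shortExact_map_of_isZero_leftDerived F hS hX
  have : Projective (S.map F).X₂ := adj.map_projective _ hP
  refine (extOneVanishes_iff_of_projective hFS Y).trans
    (Iff.trans ⟨fun h φ => ?_, fun h φ => ?_⟩ (extOneVanishes_iff_of_projective hS _).symm)
  · replace h : ∀ φ : F.obj S.X₁ ⟶ Y, ∃ ψ : F.obj S.X₂ ⟶ Y, F.map S.f ≫ ψ = φ := h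
    obtain ⟨ψ, hψ⟩ := h ((adj.homEquiv _ _).symm φ)
    refine ⟨adj.homEquiv _ _ ψ, ?_⟩
    rw [← adj.homEquiv_naturality_left, hψ, Equiv.apply_symm_apply]
  · change F.obj S.X₁ ⟶ Y at φ
    change ∃ ψ : F.obj S.X₂ ⟶ Y, F.map S.f ≫ ψ = φ
    obtain ⟨ψ, hψ⟩ := h (adj.homEquiv _ _ φ)
    refine ⟨(adj.homEquiv _ _).symm ψ, ?_⟩
    rw [← adj.homEquiv_naturality_left_symm, hψ, Equiv.symm_apply_apply]

/-- `Ext¹(F X, Y) = 0` if and only if `Ext¹(X, G Y) = 0`, for `F ⊣ G` with `F` exact and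
`R¹G` vanishing at `Y`. -/
theorem CategoryTheory.Adjunction.extOneVanishes_iff_of_rightDerived [EnoughInjectives C]
    [EnoughInjectives D] {F : C ⥤ D} {G : D ⥤ C}
    (adj : F ⊣ G) [G.Additive] [F.PreservesMonomorphisms] (X : C) {Y : D}
    (hY : IsZero ((G.rightDerived 1).obj Y)) :
    ExtOneVanishes (F.obj X) Y ↔ ExtOneVanishes X (G.obj Y) := by
  have := adj.rightAdjoint_preservesLimits
  have : F.op.PreservesEpimorphisms :=
    ⟨fun f _ => inferInstanceAs (Epi (F.map f.unop).op)⟩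
  rw [← extOneVanishes_op_iff, ← extOneVanishes_op_iff X]
  exact (adj.op.extOneVanishes_iff_of_leftDerived
    ((isZero_leftDerived_one_op_iff G Y).2 hY) (Opposite.op X)).symm

end Adjunction

/-! ### Canonical sequences of a recollement and condition (P) -/

namespace AbelianRecollement

section

variable {A' : Type u'} [Category.{v'} A'] [Abelian A']
  {A : Type u} [Category.{v} A] [Abelian A]
  {A'' : Type u''} [Category.{v''} A''] [Abelian A'']
  (R : AbelianRecollement A' A A'')

attribute [instance] full_iLowerStar faithful_iLowerStar full_jLowerShriek faithful_jLowerShriek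
  full_jLowerStar faithful_jLowerStar

instance preservesFiniteLimits_iLowerStar : PreservesFiniteLimits R.iLowerStar := by
  have := R.adjIStar.rightAdjoint_preservesLimits
  infer_instance

instance preservesFiniteColimits_iLowerStar : PreservesFiniteColimits R.iLowerStar := by
  have := R.adjIShriek.leftAdjoint_preservesColimits
  infer_instance

instance preservesFiniteLimits_jUpperStar : PreservesFiniteLimits R.jUpperStar := by
  have := R.adjJShriek.rightAdjoint_preservesLimits
  infer_instance

instance preservesFiniteColimits_jUpperStar : PreservesFiniteColimits R.jUpperStar := by
  have := R.adjJStar.leftAdjoint_preservesColimits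
  infer_instance

instance preservesFiniteColimits_iUpperStar : PreservesFiniteColimits R.iUpperStar := by
  have := R.adjIStar.leftAdjoint_preservesColimits
  infer_instance

instance preservesFiniteColimits_jLowerShriek : PreservesFiniteColimits R.jLowerShriek := by
  have := R.adjJShriek.leftAdjoint_preservesColimits
  infer_instance

instance preservesFiniteLimits_iUpperShriek : PreservesFiniteLimits R.iUpperShriek := by
  have := R.adjIShriek.rightAdjoint_preservesLimits
  infer_instance

instance preservesFiniteLimits_jLowerStar : PreservesFiniteLimits R.jLowerStar := by
  have := R.adjJStar.rightAdjoint_preservesLimits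
  infer_instance

/-- The opposite recollement. -/
def op : AbelianRecollement A'ᵒᵖ Aᵒᵖ A''ᵒᵖ where
  iUpperStar := R.iUpperShriek.op
  iLowerStar := R.iLowerStar.op
  iUpperShriek := R.iUpperStar.op
  jLowerShriek := R.jLowerStar.op
  jUpperStar := R.jUpperStar.op
  jLowerStar := R.jLowerShriek.op
  adjIStar := R.adjIShriek.op
  adjIShriek := R.adjIStar.op
  adjJShriek := R.adjJStar.op
  adjJStar := R.adjJShriek.op
  full_iLowerStar := inferInstance
  faithful_iLowerStar := inferInstance
  full_jLowerShriek := inferInstance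
  faithful_jLowerShriek := inferInstance
  full_jLowerStar := inferInstance
  faithful_jLowerStar := inferInstance
  kernel_eq_image X := by
    refine Iff.trans ⟨fun h => h.unop, fun h => h.op⟩ ((R.kernel_eq_image X.unop).trans ?_)
    exact ⟨fun ⟨Y, ⟨e⟩⟩ => ⟨Opposite.op Y, ⟨e.symm.op⟩⟩, fun ⟨Y, ⟨e⟩⟩ => ⟨Y.unop, ⟨e.symm.unop⟩⟩⟩

/-- `i^* i_* X ≅ X`. -/
noncomputable def iUpperStarILowerStarIso (X : A') :
    R.iUpperStar.obj (R.iLowerStar.obj X) ≅ X :=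
  asIso (R.adjIStar.counit.app X)

/-- `j^* j_* Y ≅ Y`. -/
noncomputable def jUpperStarJLowerStarIso (Y : A'') :
    R.jUpperStar.obj (R.jLowerStar.obj Y) ≅ Y :=
  asIso (R.adjJStar.counit.app Y)

/-- `j^* j_! Y ≅ Y`. -/
noncomputable def jUpperStarJLowerShriekIso (Y : A'') :
    R.jUpperStar.obj (R.jLowerShriek.obj Y) ≅ Y :=
  (asIso (R.adjJShriek.unit.app Y)).symm

theorem isZero_jUpperStar_iLowerStar (X : A') :
    IsZero (R.jUpperStar.obj (R.iLowerStar.obj X)) :=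
  (R.kernel_eq_image _).2 (R.iLowerStar.obj_mem_essImage X)

theorem isZero_iUpperStar_jLowerShriek (Y : A'') :
    IsZero (R.iUpperStar.obj (R.jLowerShriek.obj Y)) := by
  rw [IsZero.iff_id_eq_zero]
  apply (R.adjIStar.homEquiv _ _).injective
  apply (R.adjJShriek.homEquiv _ _).injective
  exact (R.isZero_jUpperStar_iLowerStar _).eq_of_tgt _ _

theorem counit_comp_unit (X : A) :
    R.adjJShriek.counit.app X ≫ R.adjIStar.unit.app X = 0 := by
  apply (R.adjJShriek.homEquiv _ _).injective
  exact (R.isZero_jUpperStar_iLowerStar _).eq_of_tgt _ _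

/-- The sequence `j_! j^* X ⟶ X ⟶ i_* i^* X`. -/
abbrev leftComplex (X : A) : ShortComplex A :=
  ShortComplex.mk (R.adjJShriek.counit.app X) (R.adjIStar.unit.app X) (R.counit_comp_unit X)

instance epi_jUpperStar_map_counit (X : A) : Epi (R.jUpperStar.map (R.adjJShriek.counit.app X)) :=
  (SplitEpi.mk _ (R.adjJShriek.right_triangle_components X)).epi

/-- The cokernel is killed by j^*, hence has the form i_*W; any map i_*i^*X ⟶ i_*W vanishing on the
unit is zero by adjunction and fullness of i_*. -/
theorem epi_unit (X : A) : Epi (R.adjIStar.unit.app X) := by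
  let q := cokernel.π (R.adjIStar.unit.app X)
  have h0 : IsZero (R.jUpperStar.obj (cokernel (R.adjIStar.unit.app X))) :=
    (R.isZero_jUpperStar_iLowerStar _).of_epi (R.jUpperStar.map q)
  obtain ⟨W, ⟨e⟩⟩ := (R.kernel_eq_image _).1 h0
  obtain ⟨g, hg⟩ := R.iLowerStar.map_surjective (q ≫ e.inv)
  have h1 : g = 0 := by
    apply (R.adjIStar.homEquiv _ _).injective
    simp [Adjunction.homEquiv_unit, hg, q]
  have hq : q = 0 := by
    rw [← cancel_mono e.inv, ← hg, h1, Functor.map_zero, zero_comp]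
  exact Preadditive.epi_of_cokernel_zero hq

/-- The cokernel of the counit is killed by j^*, hence has the form i_*W, so its projection factors
through the unit. Thus the kernel of the unit lies in the image of the counit. -/
theorem exact_leftComplex (X : A) : (R.leftComplex X).Exact := by
  let q : X ⟶ cokernel (R.adjJShriek.counit.app X) := cokernel.π _
  have h0 : IsZero (R.jUpperStar.obj (cokernel (R.adjJShriek.counit.app X))) := by
    have : R.jUpperStar.map q = 0 := by
      rw [← cancel_epi (R.jUpperStar.map (R.adjJShriek.counit.app X)), ← Functor.map_comp]
      simp [q]
    exact IsZero.of_epi_eq_zero _ this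
  obtain ⟨W, ⟨e⟩⟩ := (R.kernel_eq_image _).1 h0
  have hfac : R.adjIStar.unit.app X ≫
      R.iLowerStar.map ((R.adjIStar.homEquiv _ _).symm (q ≫ e.inv)) = q ≫ e.inv :=
    (Adjunction.homEquiv_unit ..).symm.trans (Equiv.apply_symm_apply _ _)
  rw [ShortComplex.exact_iff_exact_up_to_refinements]
  intro T (x : T ⟶ X) (hx : x ≫ R.adjIStar.unit.app X = 0)
  have hxq : x ≫ q = 0 := by
    rw [← cancel_mono e.inv, Category.assoc, ← hfac, reassoc_of% hx, zero_comp, zero_comp]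
  exact (ShortComplex.exact_cokernel (R.adjJShriek.counit.app X)).exact_up_to_refinements x hxq

/-- Condition (P) is self-dual. -/
theorem ConditionP.op [EnoughProjectives A] {R : AbelianRecollement A' A A''}
    (hP : R.ConditionP) : R.op.ConditionP := by
  suffices ∀ I : A, Injective I → Epi (R.adjJStar.unit.app I) by
    intro P hPP
    have := this P.unop inferInstance
    exact inferInstanceAs (Mono (R.adjJStar.unit.app P.unop).op)
  intro I _
  -- Take a projective P mapping onto the cokernel and lift p to g : P ⟶ j_*j^*I. The transpose of g
  -- gives j_!j^*P ⟶ I, which extends along the monomorphism c to h : P ⟶ I since I is injective.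
  -- Then g factors through the unit, so p = 0.
  let q := cokernel.π (R.adjJStar.unit.app I)
  let p := Projective.π (cokernel (R.adjJStar.unit.app I))
  let g : Projective.over (cokernel (R.adjJStar.unit.app I)) ⟶ _ := Projective.factorThru p q
  have hg : g ≫ q = p := Projective.factorThru_comp p q
  let a := (R.adjJStar.homEquiv _ _).symm g
  have := hP _ (Projective.projective_over (cokernel (R.adjJStar.unit.app I)))
  let c := R.adjJShriek.counit.app (Projective.over (cokernel (R.adjJStar.unit.app I)))
  let h := Injective.factorThru (R.jLowerShriek.map a ≫ R.adjJShriek.counit.app I) c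
  have hh : c ≫ h = R.jLowerShriek.map a ≫ R.adjJShriek.counit.app I :=
    Injective.comp_factorThru _ _
  have hja : R.jUpperStar.map h = a := by
    rw [← cancel_epi (R.jUpperStar.map c), ← Functor.map_comp, hh]
    have : IsIso (R.adjJShriek.unit.app (R.jUpperStar.obj
      (Projective.over (cokernel (R.adjJStar.unit.app I))))) := inferInstance
    rw [← cancel_epi (R.adjJShriek.unit.app (R.jUpperStar.obj
      (Projective.over (cokernel (R.adjJStar.unit.app I)))))]
    simp [c]
  have hgu : h ≫ R.adjJStar.unit.app I = g := by
    apply (R.adjJStar.homEquiv _ _).symm.injective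
    rw [Adjunction.homEquiv_counit]
    simpa using hja
  have hp : p = 0 := by
    rw [← hg, ← hgu, Category.assoc, cokernel.condition, comp_zero]
  have hz : IsZero (cokernel (R.adjJStar.unit.app I)) := IsZero.of_epi_eq_zero p hp
  exact Preadditive.epi_of_isZero_cokernel _ hz

/-- Snake lemma for the counits over 0 ⟶ K ⟶ P ⟶ X ⟶ 0 with P projective: their cokernels are the
i_*i^* terms and the counit at P is injective, so the kernel of the counit at X is that of i_*i^*K ⟶
i_*i^*P. The latter vanishes iff L₁i^*(X) = 0. -/
theorem isZero_leftDerived_iUpperStar_iff [EnoughProjectives A] {R : AbelianRecollement A' A A''}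
    (hP : R.ConditionP) (X : A) :
    IsZero ((R.iUpperStar.leftDerived 1).obj X) ↔ Mono (R.adjJShriek.counit.app X) := by
  obtain ⟨S, hS, hSP, rfl⟩ := exists_projective_presentation X
  have := hS.mono_f
  have := hS.epi_g
  have := hP _ hSP
  have nε {Y Z : A} (f : Y ⟶ Z) : R.jLowerShriek.map (R.jUpperStar.map f) ≫
    R.adjJShriek.counit.app Z = R.adjJShriek.counit.app Y ≫ f := R.adjJShriek.counit.naturality f
  have nη {Y Z : A} (f : Y ⟶ Z) : f ≫ R.adjIStar.unit.app Z =
    R.adjIStar.unit.app Y ≫ R.iLowerStar.map (R.iUpperStar.map f) := R.adjIStar.unit.naturality f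
  rw [isZero_leftDerived_one_iff R.iUpperStar hS]
  constructor
  · intro h
    rw [Preadditive.mono_iff_cancel_zero]
    intro T z hz
    obtain ⟨T₁, π₁, _, y, hy⟩ := surjective_up_to_refinements_of_epi
      (R.jLowerShriek.map (R.jUpperStar.map S.g)) z
    obtain ⟨k, hk⟩ := hS.exact.lift' (y ≫ R.adjJShriek.counit.app S.X₂) (by
      rw [Category.assoc, ← nε, ← reassoc_of% hy, hz, comp_zero])
    have hkη : k ≫ R.adjIStar.unit.app S.X₁ = 0 := by
      rw [← cancel_mono (R.iLowerStar.map (R.iUpperStar.map S.f)), Category.assoc, ← nη,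
        reassoc_of% hk, R.counit_comp_unit, comp_zero, zero_comp]
    obtain ⟨T₂, π₂, _, (w : T₂ ⟶ R.jLowerShriek.obj (R.jUpperStar.obj S.X₁)),
      (hw : π₂ ≫ k = w ≫ R.adjJShriek.counit.app S.X₁)⟩ :=
        (R.exact_leftComplex S.X₁).exact_up_to_refinements k hkη
    -- Condition (P) enters here: the counit at the projective `S.X₂` can be cancelled.
    have hyw : π₂ ≫ y = w ≫ R.jLowerShriek.map (R.jUpperStar.map S.f) := by
      rw [← cancel_mono (R.adjJShriek.counit.app S.X₂), Category.assoc, Category.assoc, nε, ← hk,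
        reassoc_of% hw]
    rw [← cancel_epi π₁, ← cancel_epi π₂, hy, reassoc_of% hyw, ← Functor.map_comp,
      ← Functor.map_comp, S.zero]
    simp
  · intro h
    suffices Mono (R.iLowerStar.map (R.iUpperStar.map S.f)) from
      R.iLowerStar.mono_of_mono_map this
    have := R.epi_unit S.X₁
    rw [Preadditive.mono_iff_cancel_zero]
    intro T z hz
    obtain ⟨T₁, π₁, _, (k : T₁ ⟶ S.X₁), hk⟩ :=
      surjective_up_to_refinements_of_epi (R.adjIStar.unit.app S.X₁) z
    have hkη : (k ≫ S.f) ≫ R.adjIStar.unit.app S.X₂ = 0 := by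
      rw [Category.assoc, nη, ← reassoc_of% hk, hz, comp_zero]
    obtain ⟨T₂, π₂, _, (y : T₂ ⟶ R.jLowerShriek.obj (R.jUpperStar.obj S.X₂)),
      (hy : π₂ ≫ k ≫ S.f = y ≫ R.adjJShriek.counit.app S.X₂)⟩ :=
        (R.exact_leftComplex S.X₂).exact_up_to_refinements _ hkη
    have hyg : y ≫ R.jLowerShriek.map (R.jUpperStar.map S.g) = 0 := by
      rw [← cancel_mono (R.adjJShriek.counit.app S.X₃), Category.assoc, nε, ← reassoc_of% hy]
      simp
    have hex : ((S.map R.jUpperStar).map R.jLowerShriek).Exact :=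
      (hS.map_of_exact R.jUpperStar).exact.map_of_epi_of_preservesCokernel R.jLowerShriek
        (hS.map_of_exact R.jUpperStar).epi_g inferInstance
    obtain ⟨T₃, π₃, _, (w : T₃ ⟶ R.jLowerShriek.obj (R.jUpperStar.obj S.X₁)),
      (hw : π₃ ≫ y = w ≫ R.jLowerShriek.map (R.jUpperStar.map S.f))⟩ :=
        hex.exact_up_to_refinements y hyg
    have hwk : π₃ ≫ π₂ ≫ k = w ≫ R.adjJShriek.counit.app S.X₁ := by
      rw [← cancel_mono S.f]
      simp only [Category.assoc]
      rw [hy, reassoc_of% hw, nε]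
    rw [← cancel_epi π₁, ← cancel_epi π₂, ← cancel_epi π₃, hk, reassoc_of% hwk,
      R.counit_comp_unit]
    simp

theorem shortExact_leftComplex [EnoughProjectives A] {R : AbelianRecollement A' A A''}
    (hP : R.ConditionP) {X : A} (hX : IsZero ((R.iUpperStar.leftDerived 1).obj X)) :
    (R.leftComplex X).ShortExact where
  exact := R.exact_leftComplex X
  mono_f := (isZero_leftDerived_iUpperStar_iff hP X).1 hX
  epi_g := R.epi_unit X

theorem isZero_leftDerived_iUpperStar_iLowerStar [EnoughProjectives A]
    {R : AbelianRecollement A' A A''} (hP : R.ConditionP) (X : A') :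
    IsZero ((R.iUpperStar.leftDerived 1).obj (R.iLowerStar.obj X)) := by
  rw [isZero_leftDerived_iUpperStar_iff hP]
  exact (R.jLowerShriek.map_isZero (R.isZero_jUpperStar_iLowerStar X)).mono _

theorem isZero_leftDerived_iUpperStar_jLowerShriek [EnoughProjectives A]
    {R : AbelianRecollement A' A A''} (hP : R.ConditionP) (Y : A'') :
    IsZero ((R.iUpperStar.leftDerived 1).obj (R.jLowerShriek.obj Y)) := by
  rw [isZero_leftDerived_iUpperStar_iff hP]
  -- The counit at j_!Y is invertible because j_! is fully faithful.
  infer_instance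

theorem gluedM_op [EnoughInjectives A] (V' : ObjectProperty A') (V'' : ObjectProperty A'') :
    R.op.gluedM V'.op V''.op = (R.gluedN V' V'').op := by
  funext X
  exact propext (and_congr_right' (and_congr_right'
    (isZero_leftDerived_one_op_iff R.iUpperShriek X.unop)))

theorem gluedN_op [EnoughProjectives A] (U' : ObjectProperty A') (U'' : ObjectProperty A'') :
    R.op.gluedN U'.op U''.op = (R.gluedM U' U'').op := by
  funext X
  exact propext (and_congr_right' (and_congr_right'
    (isZero_rightDerived_one_op_iff R.iUpperStar X.unop)))

/-- The sequence `i_* i^! X ⟶ X ⟶ j_* j^* X`. -/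
abbrev rightComplex (X : A) : ShortComplex A :=
  ShortComplex.mk (R.adjIShriek.counit.app X) (R.adjJStar.unit.app X)
    (Quiver.Hom.op_inj (R.op.counit_comp_unit (Opposite.op X)))

theorem shortExact_rightComplex [EnoughProjectives A] [EnoughInjectives A]
    {R : AbelianRecollement A' A A''}
    (hP : R.ConditionP) {X : A} (hX : IsZero ((R.iUpperShriek.rightDerived 1).obj X)) :
    (R.rightComplex X).ShortExact :=
  (shortExact_leftComplex hP.op ((isZero_leftDerived_one_op_iff R.iUpperShriek X).2 hX)).unop

end

end AbelianRecollement

/-! ### Duality and formal properties of cotorsion pairs -/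

section Opposite

variable {C : Type u} [Category.{v} C] [Abelian C] {𝒞 𝒟 : ObjectProperty C}

theorem rightExtPerp_op [EnoughProjectives C] [EnoughInjectives C] (𝒟 : ObjectProperty C) :
    rightExtPerp 𝒟.op = (leftExtPerp 𝒟).op := by
  funext X
  exact propext ⟨fun h D hD => (extOneVanishes_op_iff _ _).1 (h (Opposite.op D) hD),
    fun h Z hZ => (extOneVanishes_op_iff _ _).2 (h Z.unop hZ)⟩

theorem leftExtPerp_op [EnoughProjectives C] [EnoughInjectives C] (𝒞 : ObjectProperty C) :
    leftExtPerp 𝒞.op = (rightExtPerp 𝒞).op := by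
  funext X
  exact propext ⟨fun h D hD => (extOneVanishes_op_iff _ _).1 (h (Opposite.op D) hD),
    fun h Z hZ => (extOneVanishes_op_iff _ _).2 (h Z.unop hZ)⟩

theorem IsCotorsionPair.op [EnoughProjectives C] [EnoughInjectives C]
    (h : IsCotorsionPair 𝒞 𝒟) : IsCotorsionPair 𝒟.op 𝒞.op where
  rightPerp_eq := by rw [rightExtPerp_op, h.leftPerp_eq]
  leftPerp_eq := by rw [leftExtPerp_op, h.rightPerp_eq]

theorem IsCompletePair.op (h : IsCompletePair 𝒞 𝒟) : IsCompletePair 𝒟.op 𝒞.op where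
  exists_precover M := by
    obtain ⟨D, E, k, f, w, hS, hE, hD⟩ := h.exists_preenvelope M.unop
    exact ⟨_, _, f.op, k.op, congrArg Quiver.Hom.op w, hS.op, hD, hE⟩
  exists_preenvelope M := by
    obtain ⟨D, E, k, f, w, hS, hE, hD⟩ := h.exists_precover M.unop
    exact ⟨_, _, f.op, k.op, congrArg Quiver.Hom.op w, hS.op, hD, hE⟩

theorem IsCompletePair.of_op (h : IsCompletePair 𝒟.op 𝒞.op) : IsCompletePair 𝒞 𝒟 where
  exists_precover M := by
    obtain ⟨D, E, k, f, w, hS, hE, hD⟩ := h.exists_preenvelope (Opposite.op M)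
    exact ⟨_, _, f.unop, k.unop, congrArg Quiver.Hom.unop w, hS.unop, hD, hE⟩
  exists_preenvelope M := by
    obtain ⟨D, E, k, f, w, hS, hE, hD⟩ := h.exists_precover (Opposite.op M)
    exact ⟨_, _, f.unop, k.unop, congrArg Quiver.Hom.unop w, hS.unop, hD, hE⟩

theorem IsHereditaryPair.op (h : IsHereditaryPair 𝒞 𝒟) : IsHereditaryPair 𝒟.op 𝒞.op where
  kernel_mem S hS h₂ h₃ := h.cokernel_mem S.unop hS.unop h₃ h₂
  cokernel_mem S hS h₁ h₂ := h.kernel_mem S.unop hS.unop h₂ h₁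

theorem IsCompleteHereditaryCotorsionPair.op [EnoughProjectives C] [EnoughInjectives C]
    (h : IsCompleteHereditaryCotorsionPair 𝒞 𝒟) :
    IsCompleteHereditaryCotorsionPair 𝒟.op 𝒞.op where
  cotorsion := h.cotorsion.op
  complete := h.complete.op
  hereditary := h.hereditary.op

theorem IsCotorsionPair.mem_left_of_isZero [EnoughProjectives C] (h : IsCotorsionPair 𝒞 𝒟)
    {X : C} (hX : IsZero X) : 𝒞 X := by
  rw [← h.leftPerp_eq]
  exact fun D _ => ExtOneVanishes.of_isZero_left hX D

theorem IsCotorsionPair.extOneVanishes [EnoughProjectives C] (h : IsCotorsionPair 𝒞 𝒟)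
    {X Y : C} (hX : 𝒞 X) (hY : 𝒟 Y) : ExtOneVanishes X Y := by
  rw [← h.leftPerp_eq] at hX
  exact hX Y hY

theorem IsCotorsionPair.mem_right_of_shortExact [EnoughProjectives C] (h : IsCotorsionPair 𝒞 𝒟)
    {S : ShortComplex C} (hS : S.ShortExact) (h₁ : 𝒟 S.X₁) (h₃ : 𝒟 S.X₃) : 𝒟 S.X₂ := by
  rw [← h.rightPerp_eq]
  exact fun Z hZ => .of_shortExact_right hS (h.extOneVanishes hZ h₁) (h.extOneVanishes hZ h₃)

theorem exists_precover_of_iso {S : ShortComplex C} (hS : S.ShortExact) (h₂ : 𝒞 S.X₂)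
    (h₁ : 𝒟 S.X₁) {M : C} (e : S.X₃ ≅ M) :
    ∃ (D₁ C₁ : C) (k : D₁ ⟶ C₁) (f : C₁ ⟶ M) (w : k ≫ f = 0),
      (ShortComplex.mk k f w).ShortExact ∧ 𝒞 C₁ ∧ 𝒟 D₁ := by
  refine ⟨S.X₁, S.X₂, S.f, S.g ≫ e.hom, by simp, ?_, h₂, h₁⟩
  exact ShortComplex.shortExact_of_iso
    (ShortComplex.isoMk (S₁ := S) (Iso.refl _) (Iso.refl _) e (by simp) (by simp)) hS

theorem exists_preenvelope_of_iso {S : ShortComplex C} (hS : S.ShortExact) (h₃ : 𝒞 S.X₃)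
    (h₂ : 𝒟 S.X₂) {M : C} (e : S.X₁ ≅ M) :
    ∃ (D₂ C₂ : C) (g : M ⟶ D₂) (p : D₂ ⟶ C₂) (w : g ≫ p = 0),
      (ShortComplex.mk g p w).ShortExact ∧ 𝒞 C₂ ∧ 𝒟 D₂ := by
  refine ⟨S.X₂, S.X₃, e.inv ≫ S.f, S.g, by simp, ?_, h₃, h₂⟩
  exact ShortComplex.shortExact_of_iso
    (ShortComplex.isoMk (S₁ := S) e (Iso.refl _) (Iso.refl _) (by simp) (by simp)) hS

end Opposite

/-! ### Descent of the glued cotorsion pair to A' and A'' -/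

namespace AbelianRecollement

variable {A' : Type u'} [Category.{v'} A'] [Abelian A']
  {A : Type u} [Category.{v} A] [Abelian A] [EnoughProjectives A] [EnoughInjectives A]
  {A'' : Type u''} [Category.{v''} A''] [Abelian A'']
  {R : AbelianRecollement A' A A''} {U' V' : ObjectProperty A'} {U'' V'' : ObjectProperty A''}

theorem glued_op (hMN : IsCompleteHereditaryCotorsionPair (R.gluedM U' U'') (R.gluedN V' V'')) :
    IsCompleteHereditaryCotorsionPair (R.op.gluedM V'.op V''.op) (R.op.gluedN U'.op U''.op) := by
  rw [gluedM_op, gluedN_op]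
  exact hMN.op

theorem isCompletePair_of_glued_right
    (hMN : IsCompletePair (R.gluedM U' U'') (R.gluedN V' V'')) : IsCompletePair U'' V'' := by
  constructor
  · intro M
    obtain ⟨D, E, k, f, w, hS, hE, hD⟩ := hMN.exists_precover (R.jLowerStar.obj M)
    exact exists_precover_of_iso (hS.map_of_exact R.jUpperStar) hE.2.1 hD.2.1
      (R.jUpperStarJLowerStarIso M)
  · intro M
    obtain ⟨D, E, k, f, w, hS, hE, hD⟩ := hMN.exists_preenvelope (R.jLowerStar.obj M)
    exact exists_preenvelope_of_iso (hS.map_of_exact R.jUpperStar) hE.2.1 hD.2.1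
      (R.jUpperStarJLowerStarIso M)

theorem gluedM_iLowerStar_iff [U'.IsClosedUnderIsomorphisms]
    [U''.IsClosedUnderIsomorphisms] (hP : R.ConditionP)
    (hMN : IsCotorsionPair (R.gluedM U' U'') (R.gluedN V' V'')) (X : A') :
    R.gluedM U' U'' (R.iLowerStar.obj X) ↔ U' X := by
  have e := R.iUpperStarILowerStarIso X
  refine ⟨fun h => U'.prop_of_iso e h.1, fun h => ⟨U'.prop_of_iso e.symm h, ?_,
    isZero_leftDerived_iUpperStar_iLowerStar hP X⟩⟩
  -- M contains 0 as the left half of a cotorsion pair, so U'' contains 0 and therefore j^*i_*X.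
  have h0 := (hMN.mem_left_of_isZero (isZero_zero A)).2.1
  exact U''.prop_of_iso ((R.jUpperStar.map_isZero (isZero_zero A)).iso
    (R.isZero_jUpperStar_iLowerStar X)) h0

theorem gluedM_jLowerShriek_iff [U'.IsClosedUnderIsomorphisms]
    [U''.IsClosedUnderIsomorphisms] (hP : R.ConditionP)
    (hMN : IsCotorsionPair (R.gluedM U' U'') (R.gluedN V' V'')) (Y : A'') :
    R.gluedM U' U'' (R.jLowerShriek.obj Y) ↔ U'' Y := by
  have e := R.jUpperStarJLowerShriekIso Y
  refine ⟨fun h => U''.prop_of_iso e h.2.1, fun h => ⟨?_, U''.prop_of_iso e.symm h,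
    isZero_leftDerived_iUpperStar_jLowerShriek hP Y⟩⟩
  have h0 := (hMN.mem_left_of_isZero (isZero_zero A)).1
  exact U'.prop_of_iso ((R.iUpperStar.map_isZero (isZero_zero A)).iso
    (R.isZero_iUpperStar_jLowerShriek Y)) h0

theorem gluedN_iLowerStar_iff [V'.IsClosedUnderIsomorphisms]
    [V''.IsClosedUnderIsomorphisms] (hP : R.ConditionP)
    (hMN : IsCompleteHereditaryCotorsionPair (R.gluedM U' U'') (R.gluedN V' V'')) (X : A') :
    R.gluedN V' V'' (R.iLowerStar.obj X) ↔ V' X := by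
  have h := gluedM_iLowerStar_iff hP.op (glued_op hMN).cotorsion (Opposite.op X)
  rwa [gluedM_op] at h

theorem gluedN_jLowerStar_iff [V'.IsClosedUnderIsomorphisms]
    [V''.IsClosedUnderIsomorphisms] (hP : R.ConditionP)
    (hMN : IsCompleteHereditaryCotorsionPair (R.gluedM U' U'') (R.gluedN V' V'')) (Y : A'') :
    R.gluedN V' V'' (R.jLowerStar.obj Y) ↔ V'' Y := by
  have h := gluedM_jLowerShriek_iff hP.op (glued_op hMN).cotorsion (Opposite.op Y)
  rwa [gluedM_op] at h

/-- For X ∈ M, L₁i^*(X) = 0 turns Ext¹(i^*X, Y) = 0 into Ext¹(X, i_*Y) = 0; hence i_*Y ∈ N. -/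
theorem rightExtPerp_le_of_glued_left [EnoughProjectives A'] [V'.IsClosedUnderIsomorphisms]
    [V''.IsClosedUnderIsomorphisms] (hP : R.ConditionP)
    (hMN : IsCompleteHereditaryCotorsionPair (R.gluedM U' U'') (R.gluedN V' V'')) :
    rightExtPerp U' ≤ V' := by
  intro Y hY
  rw [← gluedN_iLowerStar_iff hP hMN, ← hMN.cotorsion.rightPerp_eq]
  exact fun X hX => (R.adjIStar.extOneVanishes_iff_of_leftDerived hX.2.2 Y).1 (hY _ hX.1)

theorem isCotorsionPair_of_glued_left [EnoughProjectives A'] [EnoughInjectives A']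
    [U'.IsClosedUnderIsomorphisms] [U''.IsClosedUnderIsomorphisms] [V'.IsClosedUnderIsomorphisms]
    [V''.IsClosedUnderIsomorphisms] (hP : R.ConditionP)
    (hMN : IsCompleteHereditaryCotorsionPair (R.gluedM U' U'') (R.gluedN V' V'')) :
    IsCotorsionPair U' V' := by
  have hUV : ∀ X Y, U' X → V' Y → ExtOneVanishes X Y := by
    intro X Y hX hY
    have h := hMN.cotorsion.extOneVanishes ((gluedM_iLowerStar_iff hP hMN.cotorsion X).2 hX)
      ((gluedN_iLowerStar_iff hP hMN Y).2 hY)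
    rw [← R.adjIStar.extOneVanishes_iff_of_leftDerived
      (isZero_leftDerived_iUpperStar_iLowerStar hP X)] at h
    exact (extOneVanishes_congr (R.iUpperStarILowerStarIso X) (Iso.refl Y)).1 h
  have h := rightExtPerp_le_of_glued_left hP.op (glued_op hMN)
  rw [rightExtPerp_op] at h
  exact ⟨le_antisymm (rightExtPerp_le_of_glued_left hP hMN) fun Y hY X hX => hUV X Y hX hY,
    le_antisymm (ObjectProperty.op_monotone_iff.1 h) fun X hX Y hY => hUV X Y hX hY⟩

theorem kernel_mem_of_glued_left [U'.IsClosedUnderIsomorphisms] [U''.IsClosedUnderIsomorphisms]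
    (hP : R.ConditionP)
    (hMN : IsCompleteHereditaryCotorsionPair (R.gluedM U' U'') (R.gluedN V' V''))
    {S : ShortComplex A'} (hS : S.ShortExact) (h₂ : U' S.X₂) (h₃ : U' S.X₃) : U' S.X₁ := by
  rw [← gluedM_iLowerStar_iff hP hMN.cotorsion] at h₂ h₃ ⊢
  exact hMN.hereditary.kernel_mem _ (hS.map_of_exact R.iLowerStar) h₂ h₃

theorem isHereditaryPair_of_glued_left [U'.IsClosedUnderIsomorphisms]
    [U''.IsClosedUnderIsomorphisms] [V'.IsClosedUnderIsomorphisms] [V''.IsClosedUnderIsomorphisms]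
    (hP : R.ConditionP)
    (hMN : IsCompleteHereditaryCotorsionPair (R.gluedM U' U'') (R.gluedN V' V'')) :
    IsHereditaryPair U' V' where
  kernel_mem _ hS := kernel_mem_of_glued_left hP hMN hS
  cokernel_mem _ hS h₁ h₂ := kernel_mem_of_glued_left hP.op (glued_op hMN) hS.op h₂ h₁

theorem isCompletePair_of_glued_left [EnoughProjectives A'] [EnoughInjectives A']
    [U'.IsClosedUnderIsomorphisms] [U''.IsClosedUnderIsomorphisms] [V'.IsClosedUnderIsomorphisms]
    [V''.IsClosedUnderIsomorphisms] (hP : R.ConditionP)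
    (hMN : IsCompleteHereditaryCotorsionPair (R.gluedM U' U'') (R.gluedN V' V''))
    (h : ∀ Y : A'', V'' Y → V' (R.iUpperStar.obj (R.jLowerStar.obj Y)) ∧
      IsZero ((R.iUpperStar.leftDerived 1).obj (R.jLowerStar.obj Y))) :
    IsCompletePair U' V' := by
  have hN : ∀ D, R.gluedN V' V'' D → V' (R.iUpperStar.obj D) := by
    intro D hD
    -- The sequence 0 ⟶ i_*i^!D ⟶ D ⟶ j_*j^*D ⟶ 0 stays exact under i^*, so i^*D is an extension of
    -- i^*j_*j^*D by i^!D, both in V'.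
    have hS := shortExact_map_of_isZero_leftDerived R.iUpperStar
      (shortExact_rightComplex hP hD.2.2) (h _ hD.2.1).2
    exact (isCotorsionPair_of_glued_left hP hMN).mem_right_of_shortExact hS
      (V'.prop_of_iso (R.iUpperStarILowerStarIso _).symm hD.1) (h _ hD.2.1).1
  constructor
  · intro M
    obtain ⟨D, E, k, f, w, hS, hE, hD⟩ := hMN.complete.exists_precover (R.iLowerStar.obj M)
    exact exists_precover_of_iso (shortExact_map_of_isZero_leftDerived R.iUpperStar hS
      (isZero_leftDerived_iUpperStar_iLowerStar hP M)) hE.1 (hN D hD)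
      (R.iUpperStarILowerStarIso M)
  · intro M
    obtain ⟨D, E, k, f, w, hS, hE, hD⟩ := hMN.complete.exists_preenvelope (R.iLowerStar.obj M)
    -- Here the quotient is E ∈ M, so L₁i^* vanishes on it by definition of M.
    exact exists_preenvelope_of_iso (shortExact_map_of_isZero_leftDerived R.iUpperStar hS
      hE.2.2) hE.1 (hN D hD) (R.iUpperStarILowerStarIso M)

/-- R₁j_*(Y) = 0 turns Ext¹(j^*X, Y) = 0 into Ext¹(X, j_*Y) = 0 for X ∈ M; hence j_*Y ∈ N. -/
theorem rightExtPerp_le_of_glued_right [EnoughProjectives A''] [EnoughInjectives A'']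
    [V'.IsClosedUnderIsomorphisms] [V''.IsClosedUnderIsomorphisms] (hP : R.ConditionP)
    (hMN : IsCompleteHereditaryCotorsionPair (R.gluedM U' U'') (R.gluedN V' V''))
    (hR : ∀ Y : A'', rightExtPerp U'' Y → IsZero ((R.jLowerStar.rightDerived 1).obj Y)) :
    rightExtPerp U'' ≤ V'' := by
  intro Y hY
  rw [← gluedN_jLowerStar_iff hP hMN, ← hMN.cotorsion.rightPerp_eq]
  exact fun X hX => (R.adjJStar.extOneVanishes_iff_of_rightDerived X (hR Y hY)).1 (hY _ hX.2.1)

theorem isCotorsionPair_of_glued_right [EnoughProjectives A''] [EnoughInjectives A'']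
    [U'.IsClosedUnderIsomorphisms] [U''.IsClosedUnderIsomorphisms] [V'.IsClosedUnderIsomorphisms]
    [V''.IsClosedUnderIsomorphisms] (hP : R.ConditionP)
    (hMN : IsCompleteHereditaryCotorsionPair (R.gluedM U' U'') (R.gluedN V' V''))
    (hR : ∀ Y : A'', rightExtPerp U'' Y → IsZero ((R.jLowerStar.rightDerived 1).obj Y))
    (hL : ∀ Y : A'', leftExtPerp V'' Y → IsZero ((R.jLowerShriek.leftDerived 1).obj Y))
    (hLR : (∀ Y : A'', U'' Y → IsZero ((R.jLowerShriek.leftDerived 1).obj Y)) ∨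
      (∀ Y : A'', V'' Y → IsZero ((R.jLowerStar.rightDerived 1).obj Y))) :
    IsCotorsionPair U'' V'' := by
  have hUV : ∀ X Y, U'' X → V'' Y → ExtOneVanishes X Y := by
    intro X Y hX hY
    have h := hMN.cotorsion.extOneVanishes ((gluedM_jLowerShriek_iff hP hMN.cotorsion X).2 hX)
      ((gluedN_jLowerStar_iff hP hMN Y).2 hY)
    -- From Ext¹(j_!X, j_*Y) = 0, either j_! or j_* can be moved across by adjunction, and one
    -- vanishing hypothesis suffices.
    rcases hLR with hLR | hLR
    · rw [R.adjJShriek.extOneVanishes_iff_of_leftDerived (hLR X hX)] at h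
      exact (extOneVanishes_congr (Iso.refl X) (R.jUpperStarJLowerStarIso Y)).1 h
    · rw [← R.adjJStar.extOneVanishes_iff_of_rightDerived _ (hLR Y hY)] at h
      exact (extOneVanishes_congr (R.jUpperStarJLowerShriekIso X) (Iso.refl Y)).1 h
  have h := rightExtPerp_le_of_glued_right hP.op (glued_op hMN) fun Y hY =>
    (isZero_rightDerived_one_op_iff R.jLowerShriek Y.unop).2
      (hL _ (by rw [rightExtPerp_op] at hY; exact hY))
  rw [rightExtPerp_op] at h
  exact ⟨le_antisymm (rightExtPerp_le_of_glued_right hP hMN hR) fun Y hY X hX => hUV X Y hX hY,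
    le_antisymm (ObjectProperty.op_monotone_iff.1 h) fun X hX Y hY => hUV X Y hX hY⟩

/-- j_! is not exact in general, but it preserves sequences ending in U'', so heredity of M applies
to the image. -/
theorem kernel_mem_of_glued_right [EnoughProjectives A''] [U'.IsClosedUnderIsomorphisms]
    [U''.IsClosedUnderIsomorphisms] (hP : R.ConditionP)
    (hMN : IsCompleteHereditaryCotorsionPair (R.gluedM U' U'') (R.gluedN V' V''))
    (hL : ∀ Y : A'', U'' Y → IsZero ((R.jLowerShriek.leftDerived 1).obj Y))
    {S : ShortComplex A''} (hS : S.ShortExact) (h₂ : U'' S.X₂) (h₃ : U'' S.X₃) : U'' S.X₁ := by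
  have hFS := shortExact_map_of_isZero_leftDerived R.jLowerShriek hS (hL _ h₃)
  rw [← gluedM_jLowerShriek_iff hP hMN.cotorsion] at h₂ h₃ ⊢
  exact hMN.hereditary.kernel_mem _ hFS h₂ h₃

theorem isHereditaryPair_of_glued_right [EnoughProjectives A''] [EnoughInjectives A'']
    [U'.IsClosedUnderIsomorphisms] [U''.IsClosedUnderIsomorphisms] [V'.IsClosedUnderIsomorphisms]
    [V''.IsClosedUnderIsomorphisms] (hP : R.ConditionP)
    (hMN : IsCompleteHereditaryCotorsionPair (R.gluedM U' U'') (R.gluedN V' V''))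
    (hL : ∀ Y : A'', U'' Y → IsZero ((R.jLowerShriek.leftDerived 1).obj Y))
    (hR : ∀ Y : A'', V'' Y → IsZero ((R.jLowerStar.rightDerived 1).obj Y)) :
    IsHereditaryPair U'' V'' where
  kernel_mem _ hS := kernel_mem_of_glued_right hP hMN hL hS
  cokernel_mem _ hS h₁ h₂ := kernel_mem_of_glued_right hP.op (glued_op hMN)
    (fun Y hY => (isZero_leftDerived_one_op_iff R.jLowerStar Y.unop).2 (hR _ hY)) hS.op h₂ h₁

end AbelianRecollement

theorem proposition3p13
    {A' : Type u'} [Category.{v'} A'] [Abelian A'] [EnoughProjectives A'] [EnoughInjectives A']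
    {A : Type u} [Category.{v} A] [Abelian A] [EnoughProjectives A] [EnoughInjectives A]
    {A'' : Type u''} [Category.{v''} A''] [Abelian A''] [EnoughProjectives A'']
    [EnoughInjectives A'']
    (R : AbelianRecollement A' A A'') (hP : R.ConditionP)
    (U' V' : ObjectProperty A') (U'' V'' : ObjectProperty A'')
    [U'.IsClosedUnderIsomorphisms] [V'.IsClosedUnderIsomorphisms]
    [U''.IsClosedUnderIsomorphisms] [V''.IsClosedUnderIsomorphisms]
    (hMN : IsCompleteHereditaryCotorsionPair (R.gluedM U' U'') (R.gluedN V' V''))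
    (hR : ∀ Y : A'', rightExtPerp U'' Y → IsZero ((R.jLowerStar.rightDerived 1).obj Y))
    (hL : ∀ Y : A'', leftExtPerp V'' Y → IsZero ((R.jLowerShriek.leftDerived 1).obj Y))
    (hLR : (∀ Y : A'', U'' Y → IsZero ((R.jLowerShriek.leftDerived 1).obj Y)) ∨
      (∀ Y : A'', V'' Y → IsZero ((R.jLowerStar.rightDerived 1).obj Y)))
    (h : (∀ Y : A'', V'' Y → V' (R.iUpperStar.obj (R.jLowerStar.obj Y)) ∧
          IsZero ((R.iUpperStar.leftDerived 1).obj (R.jLowerStar.obj Y))) ∨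
      (∀ Y : A'', U'' Y → U' (R.iUpperShriek.obj (R.jLowerShriek.obj Y)) ∧
          IsZero ((R.iUpperShriek.rightDerived 1).obj (R.jLowerShriek.obj Y)))) :
    IsCompleteHereditaryCotorsionPair U' V' ∧ IsCompleteHereditaryCotorsionPair U'' V'' := by
  have hc' := AbelianRecollement.isCotorsionPair_of_glued_left hP hMN
  have hc'' := AbelianRecollement.isCotorsionPair_of_glued_right hP hMN hR hL hLR
  refine ⟨⟨hc', ?_, AbelianRecollement.isHereditaryPair_of_glued_left hP hMN⟩,
    ⟨hc'', AbelianRecollement.isCompletePair_of_glued_right hMN.complete,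
      AbelianRecollement.isHereditaryPair_of_glued_right hP hMN
        -- Once U'' and V'' are known to be each other's perpendiculars, the vanishing hypotheses on
        -- the perpendiculars hold on U'' and V'' themselves.
        (fun Y hY => hL Y (hc''.leftPerp_eq ▸ hY)) (fun Y hY => hR Y (hc''.rightPerp_eq ▸ hY))⟩⟩
  rcases h with h | h
  · exact AbelianRecollement.isCompletePair_of_glued_left hP hMN h
  · refine (AbelianRecollement.isCompletePair_of_glued_left hP.op
      (AbelianRecollement.glued_op hMN) fun Y hY => ⟨(h Y.unop hY).1, ?_⟩).of_op
    exact (isZero_leftDerived_one_op_iff R.iUpperShriek _).2 (h Y.unop hY).2
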